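/- Let $H$ be a finite simple connected graph with maximum degree $\Delta(H)=d\ge 6$ and clique number $\omega(H)=d-1$. Then $V(H)$ can be partitioned into two sets $V_1,V_2$ (disjoint, with union $V(H)$) such that the induced subgraph $H[V_1]$ contains no copy of $K_{d-1}$ and the induced subgraph $H[V_2]$ contains no triangle. Moreover, $V_1$ and $V_2$ can be chosen so that, in addition, $V_2$ is a stable (independent) set of $H$ that meets every maximum clique of $H$, i.e. every clique of $H$ with $d-1$ vertices. -/

import Mathlib

/-!
A graph `H` of maximum degree `d ≥ 6` and clique number `n = d - 1` has an independent set meeting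
all its `n`-cliques; this set is `V₂`, and its complement is `V₁`.

Two intersecting `n`-cliques lie in the closed neighbourhood of a common vertex, so their union has
at most `d + 1` vertices and they share almost everything. As `2 (d + 1) < 3 n`, intersecting is
therefore an equivalence relation on the `n`-cliques (`inter_nonempty_trans`), and the cliques of
one class have a common vertex (`inf_nonempty`). Call the intersection of a class its core and the
union its hull. Hajnal's inequality (`two_mul_le_card_inf_add_card_sup`) says that the sizes of core
and hull add up to at least `2 n`. A vertex of a core is adjacent to the rest of the hull, so it has
at most `d + 1 - |hull|` neighbours in other cores. Hence every vertex of a core has at most two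
neighbours in other cores, and a core in which some vertex has such a neighbour has at least
`2 n - d ≥ 4` vertices.

It remains to choose one vertex from every core such that the chosen vertices are independent.
Haxell's theorem (`exists_isTransversal`) provides this unless some family of `s` cores is dominated,
through edges between different cores, by at most `2 (s - 1)` of its vertices. These would dominate
at most `4 (s - 1)` vertices, while the `s` cores, all of whose vertices are dominated, have at
least `4 s` vertices (`notDominated_cores`).

Haxell's theorem is proved by an exchange argument. Given a transversal `T` of all colours but `a`,
one collects vertices `x₁, x₂, …`, where `xᵢ` has the colour `a` or that of a neighbour in `T` of an
earlier `xⱼ`, and is adjacent neither to the earlier vertices nor to their neighbours in `T`. Failure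
of domination allows this to continue. If some `xᵢ` has no neighbour in `T`, it is added to `T`,
or it replaces the vertex of its colour and so shrinks the neighbourhood in `T` of an earlier
vertex. These improvements are lexicographic, so the process ends with a transversal of all colours.
-/

/-! ### Independent transversals -/

namespace IndepTransversal

open Finset
open scoped Classical

variable {V κ : Type*} (G : SimpleGraph V) (c : V → κ)

/-- `T` is an independent transversal of the colour classes in `C`: a `G`-independent set with
exactly one vertex of every colour in `C` and no vertex of any other colour. -/
structure IsTransversal (C : Finset κ) (T : Finset V) : Prop where
  indep : ∀ u ∈ T, ∀ v ∈ T, ¬ G.Adj u v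
  inj : Set.InjOn c T
  image : T.image c = C

/-- The neighbours in `T` of the vertex `x`. -/
noncomputable def nbrs (T : Finset V) (x : V) : Finset V := T.filter (G.Adj x)

/-- The vertices of `T` adjacent to some entry of the list `l`. -/
noncomputable def nbrsList (T : Finset V) (l : List V) : Finset V :=
  T.filter fun t => ∃ y ∈ l, G.Adj y t

/-- The colours reached from the missing colour `a` along `l`: `a` itself and the colours of the
vertices of `T` adjacent to `l`. -/
noncomputable def reached (a : κ) (T : Finset V) (l : List V) : Finset κ :=
  insert a ((nbrsList G T l).image c)

/-- `x` has a colour reached along `l`, and it is adjacent neither to an entry of `l` nor to a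
neighbour in `T` of such an entry. -/
structure Extends (a : κ) (T : Finset V) (l : List V) (x : V) : Prop where
  mem : c x ∈ reached G c a T l
  list : ∀ y ∈ l, ¬ G.Adj y x
  trans : ∀ t ∈ nbrsList G T l, ¬ G.Adj x t

/-- Exchange sequences, with the newest entry first: every entry extends the earlier ones and has
a neighbour in `T`. -/
def IsSeq (a : κ) (T : Finset V) : List V → Prop
  | [] => True
  | x :: l => IsSeq a T l ∧ Extends G c a T l x ∧ (nbrs G T x).Nonempty

/-- `T'` improves `T` along `l`: at the oldest entry of `l` where the neighbourhoods in `T` and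
`T'` differ, the one in `T'` is strictly smaller. -/
def Improves (T T' : Finset V) : List V → Prop
  | [] => False
  | y :: l => Improves T T' l ∨ ((∀ z ∈ l, nbrs G T' z = nbrs G T z) ∧ nbrs G T' y ⊂ nbrs G T y)

variable {G c} {a : κ} {C : Finset κ} {T T' T'' : Finset V} {l : List V} {x : V}

lemma nbrsList_eq_biUnion : nbrsList G T l = l.toFinset.biUnion (nbrs G T) := by
  ext t; simp [nbrsList, nbrs]; tauto

lemma nbrsList_congr (h : ∀ z ∈ l, nbrs G T' z = nbrs G T z) :
    nbrsList G T' l = nbrsList G T l := by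
  rw [nbrsList_eq_biUnion, nbrsList_eq_biUnion]
  exact biUnion_congr rfl fun z hz => h z (by simpa using hz)

lemma Extends.congr (h : ∀ z ∈ l, nbrs G T' z = nbrs G T z) (hx : Extends G c a T l x) :
    Extends G c a T' l x := by
  have e := nbrsList_congr h
  refine ⟨?_, hx.list, ?_⟩
  · have := hx.mem
    rwa [reached, ← e] at this
  · rw [e]; exact hx.trans

lemma IsSeq.congr (h : ∀ z ∈ l, nbrs G T' z = nbrs G T z) (hl : IsSeq G c a T l) :
    IsSeq G c a T' l := by
  induction l with
  | nil => trivial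
  | cons x l ih =>
    have h' : ∀ z ∈ l, nbrs G T' z = nbrs G T z := fun z hz => h z (List.mem_cons_of_mem _ hz)
    refine ⟨ih h' hl.1, hl.2.1.congr h', ?_⟩
    rw [h x List.mem_cons_self]
    exact hl.2.2

lemma Improves.congr (h : ∀ z ∈ l, nbrs G T' z = nbrs G T z) (hl : Improves G T' T'' l) :
    Improves G T T'' l := by
  induction l with
  | nil => exact hl
  | cons x l ih =>
    have h' : ∀ z ∈ l, nbrs G T' z = nbrs G T z := fun z hz => h z (List.mem_cons_of_mem _ hz)
    rcases hl with hl | ⟨h1, h2⟩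
    · exact Or.inl (ih h' hl)
    · refine Or.inr ⟨fun z hz => (h1 z hz).trans (h' z hz), ?_⟩
      rwa [h x List.mem_cons_self] at h2

/-- Exchanging a vertex `w` adjacent to `l` for a vertex `x` not adjacent to `l` is an improvement
along `l`. -/
lemma improves_exchange {w : V} (hw : w ∈ nbrsList G T l) (hx : ∀ y ∈ l, ¬ G.Adj y x) :
    Improves G T (insert x (T.erase w)) l := by
  induction l with
  | nil => simp [nbrsList] at hw
  | cons y l ih =>
    have hx' : ∀ y ∈ l, ¬ G.Adj y x := fun z hz => hx z (List.mem_cons_of_mem _ hz)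
    have hxy := hx y List.mem_cons_self
    by_cases hwl : w ∈ nbrsList G T l
    · exact Or.inl (ih hwl hx')
    · refine Or.inr ⟨fun z hz => ?_, ?_⟩
      · have hzx := hx' z hz
        simp only [nbrsList, mem_filter, not_and, not_exists] at hw hwl
        have hzw := hwl hw.1 z hz
        ext t
        simp only [nbrs, mem_filter, mem_insert, mem_erase]
        constructor
        · rintro ⟨rfl | h, h'⟩
          · exact absurd h' hzx
          · exact ⟨h.2, h'⟩
        · rintro ⟨h, h'⟩
          exact ⟨Or.inr ⟨fun e => hzw (e ▸ h'), h⟩, h'⟩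
      · simp only [nbrsList, mem_filter, List.mem_cons, not_and, not_exists] at hw hwl
        obtain ⟨hwT, z, rfl | hz, hzw⟩ := hw
        · refine (ssubset_iff_of_subset fun t ht => ?_).2 ⟨w, by simp [nbrs, hwT, hzw], ?_⟩
          · simp only [nbrs, mem_filter, mem_insert, mem_erase] at ht ⊢
            obtain ⟨rfl | h, h'⟩ := ht
            · exact absurd h' hxy
            · exact ⟨h.2, h'⟩
          · simp only [nbrs, mem_filter, mem_insert, mem_erase]
            rintro ⟨rfl | h, h'⟩
            · exact hxy h'
            · exact h.1 rfl
        · exact absurd hzw (hwl hwT z hz)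

/-- The neighbourhoods in `T` of the entries of an exchange sequence are nonempty and pairwise
disjoint. -/
lemma IsSeq.length_le (hl : IsSeq G c a T l) : l.length ≤ (nbrsList G T l).card := by
  induction l with
  | nil => simp
  | cons x l ih =>
    have hd : Disjoint (nbrs G T x) (nbrsList G T l) := by
      rw [disjoint_left]
      intro t ht ht'
      exact hl.2.1.trans t ht' (mem_filter.1 ht).2
    have he : nbrsList G T (x :: l) = nbrs G T x ∪ nbrsList G T l := by
      ext t; simp [nbrsList, nbrs]; tauto
    rw [he, card_union_of_disjoint hd, List.length_cons]
    have := hl.2.2.card_pos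
    have := ih hl.1
    omega

lemma card_reached (hT : IsTransversal G c C T) (ha : a ∉ C) :
    (reached G c a T l).card = (nbrsList G T l).card + 1 := by
  have hs : nbrsList G T l ⊆ T := filter_subset _ _
  rw [reached, card_insert_of_notMem, card_image_of_injOn (hT.inj.mono (by exact_mod_cast hs))]
  intro h
  exact ha (hT.image ▸ image_subset_image hs h)

lemma reached_subset (hT : IsTransversal G c C T) : reached G c a T l ⊆ insert a C := by
  rw [reached, ← hT.image]
  exact insert_subset_insert _ (image_subset_image (filter_subset _ _))

/-- The vertices of an exchange sequence have reached colours. -/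
lemma IsSeq.mem_reached (hl : IsSeq G c a T l) : ∀ y ∈ l, c y ∈ reached G c a T l := by
  induction l with
  | nil => simp
  | cons x l ih =>
    have hs : reached G c a T l ⊆ reached G c a T (x :: l) := by
      refine insert_subset_insert _ (image_subset_image fun t ht => ?_)
      simp only [nbrsList, mem_filter] at ht ⊢
      exact ⟨ht.1, ht.2.imp fun y hy => ⟨List.mem_cons_of_mem _ hy.1, hy.2⟩⟩
    intro y hy
    rcases List.mem_cons.1 hy with rfl | hy
    · exact hs hl.2.1.mem
    · exact hs (ih hl.1 y hy)

/-- The domination condition: no family `S` of the colours in `C` is totally dominated by fewer than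
`2 |S| - 1` vertices of its own colours. -/
def NotDominated (G : SimpleGraph V) (c : V → κ) (C : Finset κ) : Prop :=
  ∀ S ⊆ C, S.Nonempty → ∀ Z : Finset V, (∀ z ∈ Z, c z ∈ S) → Z.card ≤ 2 * (S.card - 1) →
    ∃ v, c v ∈ S ∧ ∀ z ∈ Z, ¬ G.Adj z v

/-- An exchange sequence can be extended, because its entries and their neighbours in `T` are too
few to dominate the reached colours. -/
lemma IsSeq.exists_extends (hdom : NotDominated G c (insert a C)) (hT : IsTransversal G c C T)
    (ha : a ∉ C) (hl : IsSeq G c a T l) : ∃ x, Extends G c a T l x := by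
  have hZ : ∀ z ∈ l.toFinset ∪ nbrsList G T l, c z ∈ reached G c a T l := by
    intro z hz
    rcases mem_union.1 hz with hz | hz
    · exact hl.mem_reached z (by simpa using hz)
    · exact mem_insert_of_mem (mem_image_of_mem _ hz)
  have hcard : (l.toFinset ∪ nbrsList G T l).card ≤ 2 * ((reached G c a T l).card - 1) := by
    have h1 := card_union_le l.toFinset (nbrsList G T l)
    have h2 := l.toFinset_card_le
    have h3 := hl.length_le
    rw [card_reached hT ha]
    omega
  obtain ⟨x, hx, hx'⟩ := hdom _ (reached_subset hT) (insert_nonempty _ _) _ hZ hcard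
  exact ⟨x, hx, fun y hy => hx' y (by simp [hy]), fun t ht h => hx' t (by simp [ht]) h.symm⟩

lemma IsTransversal.exists_mem (hT : IsTransversal G c C T) {k : κ} (hk : k ∈ C) :
    ∃ t ∈ T, c t = k := by
  rwa [← hT.image, mem_image] at hk

/-- Adding to a transversal a vertex of a missing colour. -/
lemma IsTransversal.insert (hT : IsTransversal G c C T) (ha : c x ∉ C)
    (hx : ∀ t ∈ T, ¬ G.Adj x t) : IsTransversal G c (insert (c x) C) (insert x T) := by
  refine ⟨?_, ?_, by rw [image_insert, hT.image]⟩
  · intro u hu v hv huv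
    rcases mem_insert.1 hu with hu | hu <;> rcases mem_insert.1 hv with hv | hv
    · exact huv.ne (hu.trans hv.symm)
    · exact hx v hv (hu ▸ huv)
    · exact hx u hu (hv ▸ huv.symm)
    · exact hT.indep u hu v hv huv
  · have hxT : x ∉ T := fun h => ha (hT.image ▸ mem_image_of_mem c h)
    rw [coe_insert, Set.injOn_insert (by simpa using hxT)]
    refine ⟨hT.inj, ?_⟩
    rintro ⟨t, ht, e⟩
    exact ha (hT.image ▸ e ▸ mem_image_of_mem c ht)

lemma IsTransversal.erase {w : V} (hT : IsTransversal G c C T) (hw : w ∈ T) :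
    IsTransversal G c (C.erase (c w)) (T.erase w) := by
  refine ⟨fun u hu v hv => hT.indep u (mem_of_mem_erase hu) v (mem_of_mem_erase hv),
    hT.inj.mono (by simp), ?_⟩
  ext k
  simp only [mem_image, mem_erase, ← hT.image]
  constructor
  · rintro ⟨t, ⟨h1, h2⟩, rfl⟩
    exact ⟨fun e => h1 (hT.inj h2 hw e), t, h2, rfl⟩
  · rintro ⟨h1, t, h2, rfl⟩
    exact ⟨t, ⟨fun e => h1 (e ▸ rfl), h2⟩, rfl⟩

/-- If the colours `insert a C` have no independent transversal, every transversal of `C` can be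
improved along every exchange sequence. The induction is on `m`, which bounds how much longer the
sequence can become. -/
lemma IsSeq.exists_improves (hdom : NotDominated G c (insert a C)) (ha : a ∉ C)
    (hno : ∀ T, ¬ IsTransversal G c (insert a C) T) (m : ℕ) :
    ∀ (l : List V) (T : Finset V), C.card < l.length + m → IsTransversal G c C T →
      IsSeq G c a T l → ∃ T', IsTransversal G c C T' ∧ Improves G T T' l := by
  induction m with
  | zero =>
    intro l T hm hT hl
    have h1 := hl.length_le
    have h2 : (nbrsList G T l).card ≤ T.card := card_le_card (filter_subset _ _)
    have h3 : C.card = T.card := by rw [← hT.image, card_image_of_injOn hT.inj]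
    omega
  | succ m ih =>
    intro l T hm hT hl
    obtain ⟨x, hx⟩ := hl.exists_extends hdom hT ha
    induction hk : (nbrs G T x).card using Nat.strong_induction_on generalizing T with
    | _ k ihk =>
    rcases (nbrs G T x).eq_empty_or_nonempty with h0 | hne
    · have hxT : ∀ t ∈ T, ¬ G.Adj x t := fun t ht h => by
        have : t ∈ nbrs G T x := mem_filter.2 ⟨ht, h⟩
        simp [h0] at this
      rcases mem_insert.1 hx.mem with e | h
      · exact absurd (e ▸ hT.insert (e ▸ ha) hxT) (hno (Insert.insert x T))
      · obtain ⟨w, hw, e⟩ := mem_image.1 h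
        have hwT : w ∈ T := (mem_filter.1 hw).1
        refine ⟨_, ?_, improves_exchange hw hx.list⟩
        have := (hT.erase hwT).insert (x := x) (by simp [e])
          fun t ht => hxT t (mem_of_mem_erase ht)
        rwa [e, insert_erase] at this
        rw [← hT.image, ← e]
        exact mem_image_of_mem c hwT
    · obtain ⟨T', hT', h | ⟨hsame, hlt⟩⟩ :=
        ih (x :: l) T (by simp only [List.length_cons]; omega) hT ⟨hl, hx, hne⟩
      · exact ⟨T', hT', h⟩
      · obtain ⟨T'', hT'', h⟩ := ihk _ (hk ▸ card_lt_card hlt) T' hT' (hl.congr hsame)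
          (hx.congr hsame) rfl
        exact ⟨T'', hT'', h.congr hsame⟩

/-- **Haxell's theorem**: colour classes satisfying the domination condition have an independent
transversal. -/
theorem exists_isTransversal (hdom : NotDominated G c C) : ∃ T, IsTransversal G c C T := by
  induction C using Finset.induction_on with
  | empty => exact ⟨∅, by simp, by simp, by simp⟩
  | insert a C ha ih =>
    obtain ⟨T, hT⟩ := ih fun S hS => hdom S (hS.trans (subset_insert _ _))
    by_contra! hno
    obtain ⟨T', -, h⟩ := IsSeq.exists_improves hdom ha hno (C.card + 1) [] T (by simp) hT trivial
    exact h

end IndepTransversal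

/-! ### Intersecting cliques of the same size -/

namespace CliqueClass

open Finset
open scoped Classical

variable {V : Type*} [Fintype V] {H : SimpleGraph V} {n d : ℕ}

/-- **Hajnal's inequality** for a nonempty family of maximum cliques. -/
theorem two_mul_le_card_inf_add_card_sup (hfree : H.CliqueFree (n + 1)) {F : Finset (Finset V)}
    (hF : F.Nonempty) (hcl : ∀ K ∈ F, H.IsNClique n K) :
    2 * n ≤ (F.inf id).card + (F.sup id).card := by
  induction hF using Finset.Nonempty.cons_induction with
  | singleton K =>
    have := (hcl K (mem_singleton_self _)).card_eq
    simp only [inf_singleton, sup_singleton, id]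
    omega
  | cons K F hK hF ih =>
    have ih := ih fun L hL => hcl L (mem_cons_of_mem hL)
    simp only [inf_cons, sup_cons, id, inf_eq_inter, sup_eq_union]
    set A := F.inf id with hA
    set B := F.sup id with hB
    have hKn := hcl K (mem_cons_self _ _)
    have hAL : ∀ L ∈ F, A ⊆ L := fun L hL => inf_le (f := id) hL
    have hAB : A ⊆ B := fun v hv => by
      obtain ⟨L, hL⟩ := hF
      exact (le_sup (f := id) hL : L ⊆ B) (hAL L hL hv)
    -- The vertices of `A` are adjacent to all of `B`, so they extend the clique `K ∩ B`.
    have hAdj : ∀ u ∈ A, ∀ v ∈ B, u ≠ v → H.Adj u v := by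
      intro u hu v hv huv
      obtain ⟨L, hL, hvL⟩ := mem_sup.1 hv
      exact (hcl L (mem_cons_of_mem hL)).isClique (hAL L hL hu) hvL huv
    have hcli : H.IsClique (A ∪ K ∩ B : Finset V) := by
      intro u hu v hv huv
      simp only [coe_union, coe_inter, Set.mem_union, Set.mem_inter_iff, mem_coe] at hu hv
      rcases hu with hu | hu
      · exact hAdj u hu v (hv.elim (fun h => hAB h) fun h => h.2) huv
      · rcases hv with hv | hv
        · exact (hAdj v hv u hu.2 huv.symm).symm
        · exact hKn.isClique hu.1 hv.1 huv
    have hle : (A ∪ K ∩ B).card ≤ n := by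
      by_contra! h
      exact (hfree.mono h) _ ⟨hcli, rfl⟩
    have h1 := card_union_add_card_inter A (K ∩ B)
    have h2 := card_union_add_card_inter K B
    have h3 : A ∩ (K ∩ B) ⊆ K ∩ A := by
      intro v; simp only [mem_inter]; tauto
    have h4 := card_le_card h3
    have h5 := hKn.card_eq
    omega

/-- Cliques with a common vertex lie in its closed neighbourhood. -/
lemma card_sup_le (hdeg : ∀ v, (univ.filter (H.Adj v)).card ≤ d) {F : Finset (Finset V)}
    (hcl : ∀ K ∈ F, H.IsNClique n K) (hne : (F.inf id).Nonempty) : (F.sup id).card ≤ d + 1 := by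
  obtain ⟨v, hv⟩ := hne
  have hs : F.sup id ⊆ insert v (univ.filter (H.Adj v)) := by
    intro u hu
    obtain ⟨K, hK, huK⟩ := mem_sup.1 hu
    by_cases huv : u = v
    · simp [huv]
    · have hvK : v ∈ K := (inf_le (f := id) hK : F.inf id ⊆ K) hv
      simp only [mem_insert, mem_filter, mem_univ, true_and]
      exact Or.inr ((hcl K hK).isClique hvK huK (Ne.symm huv))
  have := card_le_card hs
  have := card_insert_le v (univ.filter (H.Adj v))
  have := hdeg v
  omega

lemma inter_nonempty_of_card_lt {α : Type*} {A B K : Finset α} (hA : A ⊆ K) (hB : B ⊆ K)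
    (h : K.card < A.card + B.card) : (A ∩ B).Nonempty := by
  have h1 := card_union_add_card_inter A B
  have h2 := card_le_card (union_subset hA hB)
  exact card_pos.1 (by omega)

/-- The intersection of a family of maximum cliques is large once it is nonempty. -/
lemma le_card_inf (hfree : H.CliqueFree (n + 1)) (hdeg : ∀ v, (univ.filter (H.Adj v)).card ≤ d)
    {F : Finset (Finset V)} (hF : F.Nonempty) (hcl : ∀ K ∈ F, H.IsNClique n K)
    (hne : (F.inf id).Nonempty) : 2 * n ≤ (F.inf id).card + (d + 1) :=
  (two_mul_le_card_inf_add_card_sup hfree hF hcl).trans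
    (Nat.add_le_add_left (card_sup_le hdeg hcl hne) _)

lemma le_card_inter (hfree : H.CliqueFree (n + 1))
    (hdeg : ∀ v, (univ.filter (H.Adj v)).card ≤ d) {K L : Finset V} (hK : H.IsNClique n K)
    (hL : H.IsNClique n L) (hKL : (K ∩ L).Nonempty) : 2 * n ≤ (K ∩ L).card + (d + 1) := by
  have := le_card_inf (F := {K, L}) hfree hdeg (by simp) (by simp [hK, hL])
    (by simpa [inf_insert] using hKL)
  simpa [inf_insert] using this

/-- Large maximum cliques intersect transitively, as two large subsets of the middle clique
intersect. -/
lemma inter_nonempty_trans (hfree : H.CliqueFree (n + 1))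
    (hdeg : ∀ v, (univ.filter (H.Adj v)).card ≤ d) (hn : 2 * (d + 1) < 3 * n) {K L M : Finset V}
    (hK : H.IsNClique n K) (hL : H.IsNClique n L) (hM : H.IsNClique n M)
    (hKL : (K ∩ L).Nonempty) (hLM : (L ∩ M).Nonempty) : (K ∩ M).Nonempty := by
  have h1 := le_card_inter hfree hdeg hK hL hKL
  have h2 := le_card_inter hfree hdeg hL hM hLM
  have h3 := hL.card_eq
  refine (inter_nonempty_of_card_lt (A := K ∩ L) (B := L ∩ M) inter_subset_right
    inter_subset_left (by omega)).mono ?_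
  intro v; simp only [mem_inter]; tauto

/-- **Kostochka's lemma**: pairwise intersecting large maximum cliques have a common vertex. -/
lemma inf_nonempty (hfree : H.CliqueFree (n + 1))
    (hdeg : ∀ v, (univ.filter (H.Adj v)).card ≤ d) (hn : 2 * (d + 1) < 3 * n)
    {F : Finset (Finset V)} (hF : F.Nonempty) (hcl : ∀ K ∈ F, H.IsNClique n K)
    (hint : ∀ K ∈ F, ∀ L ∈ F, (K ∩ L).Nonempty) : (F.inf id).Nonempty := by
  induction hF using Finset.Nonempty.cons_induction with
  | singleton K => simpa using hint K (mem_singleton_self _) K (mem_singleton_self _)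
  | cons K F hK hF ih =>
    have hcl' : ∀ L ∈ F, H.IsNClique n L := fun L hL => hcl L (mem_cons_of_mem hL)
    have ih := ih hcl' fun L hL M hM => hint L (mem_cons_of_mem hL) M (mem_cons_of_mem hM)
    have h1 := le_card_inf hfree hdeg hF hcl' ih
    obtain ⟨L, hL⟩ := hF
    have h2 := le_card_inter hfree hdeg (hcl K (mem_cons_self _ _)) (hcl' L hL)
      (hint K (mem_cons_self _ _) L (mem_cons_of_mem hL))
    have h3 := (hcl' L hL).card_eq
    have hAL : F.inf id ⊆ L := inf_le (f := id) hL
    refine (inter_nonempty_of_card_lt (A := K ∩ L) inter_subset_right hAL (by omega)).mono ?_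
    simp only [inf_cons, id, inf_eq_inter]
    intro v; simp only [mem_inter]; tauto

variable (H n) in
/-- The `n`-cliques that intersect `K`. -/
noncomputable def family (K : Finset V) : Finset (Finset V) :=
  univ.filter fun L => H.IsNClique n L ∧ (K ∩ L).Nonempty

variable (H n) in
/-- The vertices common to all `n`-cliques that intersect `K`. -/
noncomputable def core (K : Finset V) : Finset V := (family H n K).inf id

variable (H n) in
/-- The vertices of the `n`-cliques that intersect `K`. -/
noncomputable def hull (K : Finset V) : Finset V := (family H n K).sup id

variable (H n) in
/-- The vertices that lie in a common core with `v`: the core containing `v`, or the empty set if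
there is none. -/
noncomputable def block (v : V) : Finset V :=
  univ.filter fun u => ∃ K, H.IsNClique n K ∧ v ∈ core H n K ∧ u ∈ core H n K

lemma mem_family {K L : Finset V} :
    L ∈ family H n K ↔ H.IsNClique n L ∧ (K ∩ L).Nonempty := by simp [family]

lemma isNClique_of_mem_family {K : Finset V} : ∀ L ∈ family H n K, H.IsNClique n L :=
  fun _ hL => (mem_family.1 hL).1

lemma self_mem_family {K : Finset V} (hK : H.IsNClique n K) (hn : 0 < n) : K ∈ family H n K := by
  rw [mem_family, inter_self]
  exact ⟨hK, card_pos.1 (hK.card_eq ▸ hn)⟩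

lemma mem_of_mem_core {K L : Finset V} {v : V} (hv : v ∈ core H n K) (hL : L ∈ family H n K) :
    v ∈ L := (inf_le (f := id) hL : core H n K ⊆ L) hv

lemma mem_hull {K : Finset V} {v : V} : v ∈ hull H n K ↔ ∃ L ∈ family H n K, v ∈ L := by
  simp [hull, mem_sup]

lemma two_mul_le_card_core_add_card_hull (hfree : H.CliqueFree (n + 1)) (hn : 0 < n)
    {K : Finset V} (hK : H.IsNClique n K) :
    2 * n ≤ (core H n K).card + (hull H n K).card :=
  two_mul_le_card_inf_add_card_sup hfree ⟨K, self_mem_family hK hn⟩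
    isNClique_of_mem_family

/-- A vertex of a core is adjacent to all other vertices of the hull, which leaves few neighbours
outside. -/
lemma card_nbrs_add_card_hull_le (hdeg : ∀ v, (univ.filter (H.Adj v)).card ≤ d) (hn : 0 < n)
    {K N : Finset V} {v : V} (hK : H.IsNClique n K) (hv : v ∈ core H n K) (hN : ∀ u ∈ N, H.Adj v u)
    (hd : Disjoint N (hull H n K)) :
    N.card + (hull H n K).card ≤ d + 1 := by
  have hvh : v ∈ hull H n K := mem_hull.2 ⟨K, self_mem_family hK hn,
    mem_of_mem_core hv (self_mem_family hK hn)⟩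
  have hs : N ∪ (hull H n K).erase v ⊆ univ.filter (H.Adj v) := by
    intro u hu
    simp only [mem_filter, mem_univ, true_and]
    rcases mem_union.1 hu with hu | hu
    · exact hN u hu
    · obtain ⟨huv, hu⟩ := mem_erase.1 hu
      obtain ⟨L, hL, huL⟩ := mem_hull.1 hu
      exact (mem_family.1 hL).1.isClique (mem_of_mem_core hv hL) huL (Ne.symm huv)
  have h1 := (card_le_card hs).trans (hdeg v)
  rw [card_union_of_disjoint (hd.mono_right (erase_subset _ _)), card_erase_of_mem hvh] at h1
  omega

section Large

variable (hfree : H.CliqueFree (n + 1)) (hdeg : ∀ v, (univ.filter (H.Adj v)).card ≤ d)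
  (hn : 2 * (d + 1) < 3 * n)
include hfree hdeg hn

lemma family_congr {K L : Finset V} (hK : H.IsNClique n K) (hL : H.IsNClique n L)
    (hKL : (K ∩ L).Nonempty) : family H n K = family H n L := by
  ext M
  simp only [mem_family]
  refine and_congr_right fun hM => ⟨fun h => ?_, fun h => ?_⟩
  · exact inter_nonempty_trans hfree hdeg hn hL hK hM (by rwa [inter_comm]) h
  · exact inter_nonempty_trans hfree hdeg hn hK hL hM hKL h

lemma core_nonempty {K : Finset V} (hK : H.IsNClique n K) : (core H n K).Nonempty := by
  refine inf_nonempty hfree hdeg hn ⟨K, self_mem_family hK (by omega)⟩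
    isNClique_of_mem_family fun L hL M hM => ?_
  rw [mem_family] at hL hM
  exact inter_nonempty_trans hfree hdeg hn hL.1 hK hM.1 (by rw [inter_comm]; exact hL.2) hM.2

lemma block_eq_core {K : Finset V} {v : V} (hK : H.IsNClique n K) (hv : v ∈ core H n K) :
    block H n v = core H n K := by
  ext u
  simp only [block, mem_filter, mem_univ, true_and]
  refine ⟨?_, fun h => ⟨K, hK, hv, h⟩⟩
  rintro ⟨L, hL, hvL, huL⟩
  have hn0 : 0 < n := by omega
  have : (K ∩ L).Nonempty := ⟨v, mem_inter.2 ⟨mem_of_mem_core hv (self_mem_family hK hn0),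
    mem_of_mem_core hvL (self_mem_family hL hn0)⟩⟩
  rwa [core, family_congr hfree hdeg hn hK hL this]

lemma block_eq_core_iff {K : Finset V} {v : V} (hK : H.IsNClique n K) :
    block H n v = core H n K ↔ v ∈ core H n K := by
  refine ⟨fun h => ?_, block_eq_core hfree hdeg hn hK⟩
  obtain ⟨u, hu⟩ := core_nonempty hfree hdeg hn hK
  rw [← h] at hu
  simp only [block, mem_filter, mem_univ, true_and] at hu
  obtain ⟨L, hL, hvL, -⟩ := hu
  rw [← h, block_eq_core hfree hdeg hn hL hvL]
  exact hvL

/-- Vertices of different cores are not in each other's hulls. -/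
lemma notMem_hull {K L : Finset V} {u : V} (hK : H.IsNClique n K) (hL : H.IsNClique n L)
    (hu : u ∈ core H n L) (hne : core H n L ≠ core H n K) : u ∉ hull H n K := by
  intro h
  obtain ⟨M, hM, huM⟩ := mem_hull.1 h
  rw [mem_family] at hM
  have hLM : (L ∩ M).Nonempty :=
    ⟨u, mem_inter.2 ⟨mem_of_mem_core hu (self_mem_family hL (by omega)), huM⟩⟩
  apply hne
  rw [core, core, family_congr hfree hdeg hn hL hM.1 hLM, family_congr hfree hdeg hn hK hM.1 hM.2]

end Large

variable (H n) in
/-- The cores of the `n`-cliques. -/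
noncomputable def cores : Finset (Finset V) :=
  (univ.filter fun K => H.IsNClique n K).image (core H n)

variable (H n) in
/-- The edges of `H` between vertices of different blocks. -/
def crossGraph : SimpleGraph V where
  Adj u v := H.Adj u v ∧ block H n u ≠ block H n v
  symm := ⟨fun _ _ h => ⟨h.1.symm, h.2.symm⟩⟩
  loopless := ⟨fun _ h => h.2 rfl⟩

lemma mem_cores {S : Finset V} : S ∈ cores H n ↔ ∃ K, H.IsNClique n K ∧ core H n K = S := by
  simp [cores]

/-- For cliques two smaller than the closed neighbourhoods, the cores cannot be dominated by few
vertices: a core with a vertex that has a neighbour in another core has at least four vertices,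
whereas every vertex has at most two neighbours in other cores. -/
lemma notDominated_cores (hfree : H.CliqueFree (n + 1))
    (hdeg : ∀ v, (univ.filter (H.Adj v)).card ≤ n + 1) (hn : 5 ≤ n) :
    IndepTransversal.NotDominated (crossGraph H n) (block H n) (cores H n) := by
  have hn' : 2 * (n + 1 + 1) < 3 * n := by omega
  intro S hS hSne Z hZ hcard
  by_contra! hdom
  -- `N z` is the set of vertices dominated by `z`.
  let N : V → Finset V := fun z => univ.filter fun u =>
    block H n u ∈ S ∧ (crossGraph H n).Adj z u
  have hmem : ∀ v, block H n v ∈ S → ∃ K, H.IsNClique n K ∧ v ∈ core H n K := by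
    intro v hv
    obtain ⟨K, hK, e⟩ := mem_cores.1 (hS hv)
    exact ⟨K, hK, (block_eq_core_iff hfree hdeg hn' hK).1 e.symm⟩
  have hN : ∀ v K, H.IsNClique n K → v ∈ core H n K →
      (N v).card + (hull H n K).card ≤ n + 2 := by
    intro v K hK hv
    refine card_nbrs_add_card_hull_le hdeg (by omega) hK hv (fun u hu => (mem_filter.1 hu).2.2.1) ?_
    rw [disjoint_left]
    intro u hu
    obtain ⟨-, huS, -, hne⟩ := mem_filter.1 hu
    obtain ⟨L, hL, huL⟩ := hmem u huS
    rw [block_eq_core hfree hdeg hn' hK hv, block_eq_core hfree hdeg hn' hL huL] at hne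
    exact notMem_hull hfree hdeg hn' hK hL huL hne.symm
  have hN2 : ∀ z ∈ Z, (N z).card ≤ 2 := by
    intro z hz
    obtain ⟨K, hK, hzK⟩ := hmem z (hZ z hz)
    have h1 := hN z K hK hzK
    have h2 : K ⊆ hull H n K := fun v hv => mem_hull.2 ⟨K, self_mem_family hK (by omega), hv⟩
    have h3 := card_le_card h2
    have h4 := hK.card_eq
    omega
  have h4 : ∀ s ∈ S, 4 ≤ (univ.filter fun v => block H n v = s).card := by
    intro s hs
    obtain ⟨K, hK, rfl⟩ := mem_cores.1 (hS hs)
    have he : (univ.filter fun v => block H n v = core H n K) = core H n K := by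
      ext v; simp [block_eq_core_iff hfree hdeg hn' hK]
    rw [he]
    obtain ⟨v, hv⟩ := core_nonempty hfree hdeg hn' hK
    have hb := block_eq_core hfree hdeg hn' hK hv
    obtain ⟨z, hz, hzv⟩ := hdom v (hb ▸ hs)
    have h1 := hN v K hK hv
    have h2 : 0 < (N v).card :=
      card_pos.2 ⟨z, mem_filter.2 ⟨mem_univ _, hZ z hz, hzv.symm⟩⟩
    have h3 := two_mul_le_card_core_add_card_hull hfree (by omega) hK
    omega
  have hlow : S.card * 4 ≤ (univ.filter fun v => block H n v ∈ S).card := by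
    rw [card_eq_sum_card_fiberwise (f := block H n) (t := S) (by intro v hv; simpa using hv),
      ← smul_eq_mul]
    refine card_nsmul_le_sum _ _ _ fun s hs => (h4 s hs).trans (card_le_card fun v hv => ?_)
    have hv := (mem_filter.1 hv).2
    simp [hv, hs]
  have hup : (univ.filter fun v => block H n v ∈ S).card ≤ Z.card * 2 := by
    refine (card_le_card fun v hv => ?_).trans (card_biUnion_le_card_mul Z N 2 hN2)
    have hv := (mem_filter.1 hv).2
    obtain ⟨z, hz, hzv⟩ := hdom v hv
    exact mem_biUnion.2 ⟨z, hz, mem_filter.2 ⟨mem_univ _, hv, hzv⟩⟩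
  have := hSne.card_pos
  omega

/-- A graph of maximum degree at most `n + 1` without cliques of more than `n ≥ 5` vertices has an
independent set meeting all its `n`-cliques. -/
theorem exists_indepSet_meeting_cliques (hfree : H.CliqueFree (n + 1))
    (hdeg : ∀ v, (univ.filter (H.Adj v)).card ≤ n + 1) (hn : 5 ≤ n) :
    ∃ T : Finset V, H.IsIndepSet T ∧ ∀ K, H.IsNClique n K → ∃ v ∈ K, v ∈ T := by
  have hn' : 2 * (n + 1 + 1) < 3 * n := by omega
  obtain ⟨T, hT⟩ :=
    IndepTransversal.exists_isTransversal (notDominated_cores hfree hdeg hn)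
  refine ⟨T, fun u hu v hv huv h => ?_, fun K hK => ?_⟩
  · exact hT.indep u hu v hv ⟨h, fun e => huv (hT.inj hu hv e)⟩
  · have : core H n K ∈ cores H n := mem_cores.2 ⟨K, hK, rfl⟩
    obtain ⟨v, hv, e⟩ := hT.exists_mem this
    exact ⟨v, mem_of_mem_core ((block_eq_core_iff hfree hdeg hn' hK).1 e)
      (self_mem_family hK (by omega)), hv⟩

end CliqueClass

theorem mainTheorem5 {V : Type*} [Fintype V] (H : SimpleGraph V) [DecidableRel H.Adj]
    (d : ℕ) (hd : 6 ≤ d) (hconn : H.Connected)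
    (hΔ : H.maxDegree = d) (hω : H.cliqueNum = d - 1) :
    ∃ V₁ V₂ : Set V, V₁ ∪ V₂ = Set.univ ∧ Disjoint V₁ V₂ ∧
      (H.induce V₁).CliqueFree (d - 1) ∧
      (H.induce V₂).CliqueFree 3 ∧
      H.IsIndepSet V₂ ∧
      ∀ K : Finset V, H.IsMaximumClique K → ∃ v ∈ K, v ∈ V₂ := by
  have hfree : H.CliqueFree (d - 1 + 1) := by
    intro K hK
    have h1 := hK.isClique.card_le_cliqueNum
    have h2 := hK.card_eq
    omega
  have hdeg : ∀ v, (Finset.univ.filter (H.Adj v)).card ≤ d - 1 + 1 := by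
    intro v
    have h1 := H.degree_le_maxDegree v
    rw [← H.card_neighborFinset_eq_degree, H.neighborFinset_eq_filter] at h1
    refine le_trans (le_of_eq ?_) (h1.trans (by omega))
    congr
  obtain ⟨T, hT, hmeet⟩ := CliqueClass.exists_indepSet_meeting_cliques hfree
    (fun v => by convert hdeg v) (by omega)
  refine ⟨(T : Set V)ᶜ, T, by simp, disjoint_compl_left, ?_, ?_, hT, fun K hK => ?_⟩
  · intro K hK
    have hK' := (hK.map (f := Function.Embedding.subtype _)).mono (SimpleGraph.map_comap_le _ _)
    obtain ⟨v, hv, hvT⟩ := hmeet _ hK'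
    obtain ⟨u, -, rfl⟩ := Finset.mem_map.1 hv
    exact u.2 hvT
  · classical
    intro K hK
    obtain ⟨u, v, w, huv, -⟩ := SimpleGraph.is3Clique_iff.1 hK
    have h : H.Adj u v := huv
    exact hT u.2 v.2 h.ne h
  · exact hmeet K ⟨hK.isClique, (H.maximumClique_card_eq_cliqueNum K hK).trans hω⟩
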